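/- Let $\mathbb{K}$ be a field. For a finite simple graph $G$ on the vertex set $\{x_1,\ldots,x_n\}$ let $R=\mathbb{K}[x_1,\ldots,x_n]$ and let $I(G)=\langle x_ix_j : \{x_i,x_j\}\text{ is an edge of }G\rangle\subseteq R$ be its edge ideal. Call $G$ Cohen–Macaulay (over $\mathbb{K}$) if $\dim R/I(G)=\operatorname{depth} R/I(G)$, where $\dim$ is the Krull dimension and $\operatorname{depth}$ is the maximal length of an $R/I(G)$-regular sequence contained in the graded maximal ideal $\langle \overline{x}_1,\ldots,\overline{x}_n\rangle$. Then almost all graphs are not Cohen–Macaulay: for every fixed $p\in(0,1)$, if $G$ is the random graph on $\{x_1,\ldots,x_n\}$ in which each pair $\{x_i,x_j\}$, $i<j$, is an edge independently with probability $p$, then \[\operatorname{Prob}(G\text{ is not Cohen–Macaulay})\longrightarrow 1\quad\text{as } n\to\infty.\] -/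

import Mathlib

/-- The depth of the `S`-module `M` with respect to the ideal `I`: the supremum of the lengths
of the `M`-regular sequences whose elements lie in `I`. -/
noncomputable def Ideal.depthOn {S : Type*} [CommRing S] (I : Ideal S) (M : Type*)
    [AddCommGroup M] [Module S M] : ℕ∞ :=
  ⨆ rs ∈ {rs : List S | (∀ r ∈ rs, r ∈ I) ∧ RingTheory.Sequence.IsRegular M rs},
    (rs.length : ℕ∞)

namespace SimpleGraph

variable (K : Type*) [Field K] {V : Type*} (G : SimpleGraph V)

/-- The edge ideal `I(G)` of the polynomial ring over `K` whose variables are the vertices: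
it is generated by the products `x_i x_j` over the edges `{x_i, x_j}` of `G`. -/
noncomputable def edgeIdeal : Ideal (MvPolynomial V K) :=
  Ideal.span {f | ∃ i j : V, G.Adj i j ∧ f = MvPolynomial.X i * MvPolynomial.X j}

/-- The quotient ring `R / I(G)`. -/
abbrev EdgeRing : Type _ := MvPolynomial V K ⧸ G.edgeIdeal K

/-- The graded maximal ideal of `R / I(G)`, generated by the residue classes of the variables. -/
noncomputable def edgeRingMaximalIdeal : Ideal (G.EdgeRing K) :=
  Ideal.span (Set.range fun i : V => Ideal.Quotient.mk (G.edgeIdeal K) (MvPolynomial.X i))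

/-- `G` is a Cohen-Macaulay graph over `K`: the Krull dimension of the standard graded
`K`-algebra `R / I(G)` equals its depth, where the depth of a graded algebra is taken, as usual,
with respect to its graded maximal ideal. -/
def IsCohenMacaulay : Prop :=
  ringKrullDim (G.EdgeRing K) =
    (((G.edgeRingMaximalIdeal K).depthOn (G.EdgeRing K) : ℕ∞) : WithBot ℕ∞)

end SimpleGraph

/-- Almost all graphs have the property `P`: for every fixed edge probability `p ∈ (0, 1)`, the
probability that the random graph on `n` labelled vertices, whose edges are present
independently with probability `p`, has property `P` tends to `1` as `n → ∞`. -/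
def AlmostAllGraphs (P : ∀ n : ℕ, SimpleGraph (Fin n) → Prop) : Prop :=
  ∀ p : unitInterval, 0 < p → p < 1 →
    Filter.Tendsto (fun n : ℕ => SimpleGraph.binomialRandom (Fin n) p {G | P n G})
      Filter.atTop (nhds 1)

/-! A Cohen–Macaulay graph is unmixed: no independent set is larger than a maximal one. Indeed, a
maximal independent set `B` gives an associated prime of `R/I(G)` with quotient `K[B]`, and depth is
at most the dimension of any such quotient, so depth is at most `|B|`; any independent set `A` gives
a surjection onto `K[A]`, so the dimension is at least `|A|` (`IsCohenMacaulay.ncard_le`).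

A random graph violates this. With `q = 1 - p`, the greedy maximal independent set has about `log n`
vertices in base `1/q`, while the largest independent set has about twice as many. At the
intermediate size `t`, 3/2 of that logarithm, a union bound shows that the greedy set has at most
`t` vertices (`binomialRandom_real_greedy_card_le`), and a second moment argument gives an
independent set of size `t + 1` (`one_sub_le_binomialRandom_real_exists_isIndepSet`), both with
probability tending to 1. -/

/-! ### Regular sequences and associated primes -/

open scoped Pointwise in
theorem QuotSMulTop.map_subtype_injective {S M : Type*} [CommRing S] [AddCommGroup M] [Module S M]
    {N : Submodule S M} {x : S} (h : ∀ v : M, x • v ∈ N → v ∈ N) :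
    Function.Injective (QuotSMulTop.map x N.subtype) := by
  rw [injective_iff_map_eq_zero]
  intro w hw
  obtain ⟨v, rfl⟩ := Submodule.Quotient.mk_surjective _ w
  rw [QuotSMulTop.map_apply_mk, Submodule.Quotient.mk_eq_zero] at hw
  obtain ⟨y, -, hy⟩ := (Submodule.mem_smul_pointwise_iff_exists _ _ _).mp hw
  have hyN : y ∈ N := h y (by rw [hy]; exact v.2)
  have hv : v = x • (⟨y, hyN⟩ : N) := Subtype.ext hy.symm
  rw [Submodule.Quotient.mk_eq_zero, hv]
  exact Submodule.smul_mem_pointwise_smul _ _ _ trivial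

-- Let `N` be the elements killed by `P`. By Nakayama `N/xN` is still supported at `m`, and it
-- embeds in `M/xM` because `x` is regular. A minimal prime of its annihilator below `m` serves as
-- `Q`.
open scoped Pointwise in
theorem IsSMulRegular.exists_associatedPrimes_quotSMulTop {S M : Type*} [CommRing S]
    [IsNoetherianRing S] [AddCommGroup M] [Module S M] [Module.Finite S M] {P m : Ideal S}
    [hm : m.IsPrime] (hP : P ∈ associatedPrimes S M) (hPm : P ≤ m) {x : S} (hx : x ∈ m)
    (hreg : IsSMulRegular M x) :
    ∃ Q ∈ associatedPrimes S (QuotSMulTop x M), P ≤ Q ∧ x ∈ Q ∧ Q ≤ m := by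
  obtain ⟨-, u, hu⟩ := isAssociatedPrime_iff.mp hP
  let N : Submodule S M := Submodule.torsionBySet S M P
  have hN : ∀ {v : M}, v ∈ N ↔ ∀ a ∈ P, a • v = 0 := by
    intro v
    simp [N, Submodule.mem_torsionBySet_iff]
  have huN : u ∈ N := hN.mpr fun a ha => by
    rw [hu] at ha
    simpa [Submodule.mem_colon_singleton] using ha
  have hsupp : (⟨m, hm⟩ : PrimeSpectrum S) ∈ Module.support S N := by
    rw [Module.mem_support_iff_exists_annihilator]
    refine ⟨⟨u, huN⟩, fun a ha => hPm ?_⟩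
    rw [Submodule.mem_annihilator_span_singleton] at ha
    rw [hu, Submodule.mem_colon_singleton]
    simpa [Subtype.ext_iff] using ha
  have hsupp' : (⟨m, hm⟩ : PrimeSpectrum S) ∈ Module.support S (QuotSMulTop x N) := by
    rw [Module.support_quotSMulTop]
    exact ⟨hsupp, by simpa using hx⟩
  rw [Module.mem_support_iff_of_finite] at hsupp'
  obtain ⟨Q, hQ, hQm⟩ := Ideal.exists_minimalPrimes_le hsupp'
  refine ⟨Q, ?_, ?_, ?_, hQm⟩
  · refine (Module.associatedPrimes.minimalPrimes_annihilator_subset_associatedPrimes S _ hQ).map_of_injective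
      (QuotSMulTop.map x N.subtype) (QuotSMulTop.map_subtype_injective fun v hv => ?_)
    exact hN.mpr fun a ha => hreg <| by
      simp only [smul_zero]
      rw [smul_comm]
      exact hN.mp hv a ha
  · refine le_trans (fun a ha => ?_) hQ.1.2
    rw [Module.mem_annihilator]
    intro w
    obtain ⟨v, rfl⟩ := Submodule.mkQ_surjective _ w
    rw [← map_smul]
    have : a • v = 0 := Subtype.ext (hN.mp v.2 a ha)
    rw [this, map_zero]
  · refine hQ.1.2 (Module.mem_annihilator.mpr fun w => ?_)
    obtain ⟨v, rfl⟩ := Submodule.mkQ_surjective _ w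
    rw [← map_smul]
    exact (Submodule.Quotient.mk_eq_zero _).mpr
      (Submodule.smul_mem_pointwise_smul v x ⊤ trivial)

/-- Each `r` in the sequence lies outside `P` but inside the next prime `Q ⊇ P`, so the dimension of
the quotient drops at every step. -/
theorem RingTheory.Sequence.IsWeaklyRegular.length_le_ringKrullDim_quotient {S : Type*} [CommRing S]
    [IsNoetherianRing S] {m : Ideal S} [m.IsPrime] (rs : List S) :
    ∀ {M : Type*} [AddCommGroup M] [Module S M] [Module.Finite S M] {P : Ideal S},
      P ∈ associatedPrimes S M → P ≤ m → (∀ r ∈ rs, r ∈ m) → IsWeaklyRegular M rs →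
      (rs.length : WithBot ℕ∞) ≤ ringKrullDim (S ⧸ P) := by
  induction rs with
  | nil =>
    intro M _ _ _ P hP _ _ _
    have := hP.isPrime
    simpa using ringKrullDim_nonneg_of_nontrivial
  | cons r rs ih =>
    intro M _ _ _ P hP hPm hrs hreg
    rw [isWeaklyRegular_cons_iff] at hreg
    obtain ⟨Q, hQ, hPQ, hrQ, hQm⟩ :=
      hreg.1.exists_associatedPrimes_quotSMulTop hP hPm (hrs r (by simp))
    have hPp := hP.isPrime
    have hrP : r ∉ P := by
      obtain ⟨-, u, hu⟩ := isAssociatedPrime_iff.mp hP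
      intro hr
      rw [hu, Submodule.mem_colon_singleton, Submodule.mem_bot] at hr
      have hu0 : u = 0 := hreg.1 (by simpa using hr)
      exact hPp.ne_top (by rw [hu, hu0]; ext; simp [Submodule.mem_colon_singleton])
    have := ih hQ hQm (fun s hs => hrs s (by simp [hs])) hreg.2
    calc ((r :: rs).length : WithBot ℕ∞) = rs.length + 1 := by simp
      _ ≤ ringKrullDim (S ⧸ Q) + 1 := by gcongr
      _ ≤ ringKrullDim (S ⧸ P) :=
        ringKrullDim_succ_le_of_surjective (Ideal.Quotient.factor hPQ)
          (Ideal.Quotient.factor_surjective hPQ) (r := Ideal.Quotient.mk P r)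
          (mem_nonZeroDivisors_of_ne_zero (by rwa [Ne, Ideal.Quotient.eq_zero_iff_mem]))
          (by simpa [Ideal.Quotient.eq_zero_iff_mem] using hrQ)

/-! ### Independent sets and the edge ring -/

theorem mul_prod_eq_zero_of_mul_eq_zero {ι R : Type*} [CommRing R] {s : Finset ι} {i : ι}
    (hi : i ∈ s) {f : ι → R} {a : R} (h : a * f i = 0) : a * ∏ i ∈ s, f i = 0 := by
  obtain ⟨c, hc⟩ := Finset.dvd_prod_of_mem f hi
  rw [hc, ← mul_assoc, h, zero_mul]

namespace SimpleGraph

variable (K : Type*) [Field K] {V : Type*} (G : SimpleGraph V)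

open MvPolynomial in
open scoped Classical in
/-- The map `R / I(G) → K[F]` that kills the variables outside an independent set `F`. -/
noncomputable def edgeRingToIndep {F : Set V} (hF : G.IsIndepSet F) :
    G.EdgeRing K →ₐ[K] MvPolynomial F K :=
  Ideal.Quotient.liftₐ (G.edgeIdeal K)
    (aeval fun i => if h : i ∈ F then (X ⟨i, h⟩ : MvPolynomial F K) else 0) <| by
    suffices h : G.edgeIdeal K ≤ RingHom.ker
        (aeval fun i => if h : i ∈ F then (X ⟨i, h⟩ : MvPolynomial F K) else 0) from
      fun a ha => h ha
    refine Ideal.span_le.mpr ?_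
    rintro _ ⟨i, j, hij, rfl⟩
    simp only [SetLike.mem_coe, RingHom.mem_ker, map_mul, aeval_X]
    by_cases hi : i ∈ F
    · by_cases hj : j ∈ F
      · exact absurd hij (hF hi hj hij.ne)
      · simp [hj]
    · simp [hi]

variable {G}

/-- The residue class of the variable attached to a vertex. -/
noncomputable abbrev edgeRingX (G : SimpleGraph V) (i : V) : G.EdgeRing K :=
  Ideal.Quotient.mk (G.edgeIdeal K) (MvPolynomial.X i)

theorem edgeRingX_mul_eq_zero {i j : V} (h : G.Adj i j) :
    edgeRingX K G i * edgeRingX K G j = 0 := by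
  rw [← map_mul, Ideal.Quotient.eq_zero_iff_mem]
  exact Ideal.subset_span ⟨i, j, h, rfl⟩

theorem edgeRingToIndep_X_of_mem {F : Set V} (hF : G.IsIndepSet F) (i : F) :
    G.edgeRingToIndep K hF (edgeRingX K G i) = MvPolynomial.X i := by
  change MvPolynomial.aeval _ _ = _
  simp

theorem edgeRingToIndep_X_of_notMem {F : Set V} (hF : G.IsIndepSet F) {i : V} (hi : i ∉ F) :
    G.edgeRingToIndep K hF (edgeRingX K G i) = 0 := by
  change MvPolynomial.aeval _ _ = _
  simp [hi]

/-- The section of `edgeRingToIndep`. -/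
noncomputable def indepToEdgeRing (G : SimpleGraph V) (F : Set V) :
    MvPolynomial F K →ₐ[K] G.EdgeRing K :=
  MvPolynomial.aeval fun i : F => edgeRingX K G i

theorem edgeRingToIndep_surjective {F : Set V} (hF : G.IsIndepSet F) :
    Function.Surjective (G.edgeRingToIndep K hF) := by
  have h : (G.edgeRingToIndep K hF).comp (indepToEdgeRing K G F) = AlgHom.id K _ :=
    MvPolynomial.algHom_ext fun i => by
      simp only [indepToEdgeRing, AlgHom.comp_apply, MvPolynomial.aeval_X, AlgHom.id_apply]
      exact edgeRingToIndep_X_of_mem K hF i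
  exact fun f => ⟨indepToEdgeRing K G F f, DFunLike.congr_fun h f⟩

/-- Modulo the variables outside `F`, the identity and the retraction through `K[F]` are algebra
maps that agree on every variable. -/
theorem sub_mem_span_edgeRingX {F : Set V} (hF : G.IsIndepSet F) (f : G.EdgeRing K) :
    f - indepToEdgeRing K G F (G.edgeRingToIndep K hF f) ∈
      Ideal.span (edgeRingX K G '' Fᶜ) := by
  rw [← Ideal.Quotient.eq]
  set J := Ideal.span (edgeRingX K G '' Fᶜ)
  have h : Ideal.Quotient.mkₐ K J = ((Ideal.Quotient.mkₐ K J).comp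
      ((indepToEdgeRing K G F).comp (G.edgeRingToIndep K hF))) := by
    refine Ideal.Quotient.algHom_ext K (MvPolynomial.algHom_ext fun i => ?_)
    change Ideal.Quotient.mk J (edgeRingX K G i) = Ideal.Quotient.mk J
      (indepToEdgeRing K G F (G.edgeRingToIndep K hF (edgeRingX K G i)))
    by_cases hi : i ∈ F
    · rw [edgeRingToIndep_X_of_mem K hF ⟨i, hi⟩]
      simp [indepToEdgeRing]
    · rw [edgeRingToIndep_X_of_notMem K hF hi, map_zero, map_zero,
        Ideal.Quotient.eq_zero_iff_mem]
      exact Ideal.subset_span ⟨i, hi, rfl⟩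
  exact DFunLike.congr_fun h f

theorem ker_edgeRingToIndep {F : Set V} (hF : G.IsIndepSet F) :
    RingHom.ker (G.edgeRingToIndep K hF) = Ideal.span (edgeRingX K G '' Fᶜ) := by
  refine le_antisymm (fun f hf => ?_) (Ideal.span_le.mpr ?_)
  · have := sub_mem_span_edgeRingX K hF f
    rwa [RingHom.mem_ker.mp hf, map_zero, sub_zero] at this
  · rintro _ ⟨i, hi, rfl⟩
    exact edgeRingToIndep_X_of_notMem K hF hi

theorem ker_edgeRingToIndep_empty :
    RingHom.ker (G.edgeRingToIndep K (F := ∅) (Set.pairwise_empty _)) = G.edgeRingMaximalIdeal K := by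
  rw [ker_edgeRingToIndep, Set.compl_empty, Set.image_univ]
  rfl

instance isPrime_ker_edgeRingToIndep {F : Set V} (hF : G.IsIndepSet F) :
    (RingHom.ker (G.edgeRingToIndep K hF)).IsPrime :=
  RingHom.ker_isPrime _

/-- The kernel is the annihilator of the product of the variables in `F`: by maximality a vertex
outside `F` has a neighbour in `F`, so its variable kills the product; conversely the product stays
nonzero in the domain `K[F]`. -/
theorem ker_edgeRingToIndep_mem_associatedPrimes [Finite V] {F : Set V}
    (hF : Maximal G.IsIndepSet F) :
    RingHom.ker (G.edgeRingToIndep K hF.prop) ∈ associatedPrimes (G.EdgeRing K) (G.EdgeRing K) := by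
  cases nonempty_fintype F
  refine isAssociatedPrime_iff.mpr ⟨inferInstance, ∏ i : F, edgeRingX K G i, ?_⟩
  ext f
  rw [Submodule.mem_colon_singleton, Submodule.mem_bot, smul_eq_mul]
  constructor
  · intro hf
    rw [ker_edgeRingToIndep] at hf
    induction hf using Submodule.span_induction with
    | zero => simp
    | add a b _ _ ha hb => rw [add_mul, ha, hb, add_zero]
    | smul a b _ hb => rw [smul_eq_mul, mul_assoc, hb, mul_zero]
    | mem a ha =>
      obtain ⟨j, hj, rfl⟩ := ha
      obtain ⟨i, hi, hij⟩ : ∃ i ∈ F, G.Adj j i := by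
        by_contra! hcon
        refine hj (hF.le_of_ge (y := insert j F) ?_ (Set.subset_insert j F) (Set.mem_insert j F))
        exact hF.prop.insert fun b hb hne => ⟨hcon b hb, fun h => hcon b hb h.symm⟩
      exact mul_prod_eq_zero_of_mul_eq_zero (Finset.mem_univ (⟨i, hi⟩ : F))
        (f := fun i : F => edgeRingX K G i) (edgeRingX_mul_eq_zero K hij)
  · intro hf
    have := congrArg (G.edgeRingToIndep K hF.prop) hf
    rw [map_mul, map_zero, map_prod, mul_eq_zero] at this
    refine this.resolve_right (Finset.prod_ne_zero_iff.mpr fun i _ => ?_)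
    rw [edgeRingToIndep_X_of_mem]
    exact MvPolynomial.X_ne_zero i

theorem ringKrullDim_mvPolynomial_indep [Finite V] (F : Set V) :
    ringKrullDim (MvPolynomial F K) = F.ncard := by
  rw [MvPolynomial.ringKrullDim_of_isNoetherianRing, ringKrullDim_eq_zero_of_field, zero_add]
  rfl

theorem ncard_le_ringKrullDim_edgeRing [Finite V] {F : Set V} (hF : G.IsIndepSet F) :
    (F.ncard : WithBot ℕ∞) ≤ ringKrullDim (G.EdgeRing K) := by
  rw [← ringKrullDim_mvPolynomial_indep K]
  exact ringKrullDim_le_of_surjective (G.edgeRingToIndep K hF).toRingHom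
    (edgeRingToIndep_surjective K hF)

theorem depthOn_edgeRing_le_ncard [Finite V] {F : Set V} (hF : Maximal G.IsIndepSet F) :
    (G.edgeRingMaximalIdeal K).depthOn (G.EdgeRing K) ≤ F.ncard := by
  refine iSup₂_le fun rs hrs => ?_
  rw [← ker_edgeRingToIndep_empty] at hrs
  have hle : RingHom.ker (G.edgeRingToIndep K hF.prop) ≤
      RingHom.ker (G.edgeRingToIndep K (F := ∅) (Set.pairwise_empty _)) := by
    rw [ker_edgeRingToIndep, ker_edgeRingToIndep]
    exact Ideal.span_mono (Set.image_mono (by simp))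
  have h := hrs.2.toIsWeaklyRegular.length_le_ringKrullDim_quotient rs
    (ker_edgeRingToIndep_mem_associatedPrimes K hF) hle hrs.1
  rw [ringKrullDim_eq_of_ringEquiv (RingHom.quotientKerEquivOfSurjective
    (f := (G.edgeRingToIndep K hF.prop).toRingHom) (edgeRingToIndep_surjective K hF.prop)),
    ringKrullDim_mvPolynomial_indep] at h
  exact_mod_cast h

theorem IsCohenMacaulay.ncard_le [Finite V] (h : G.IsCohenMacaulay K) {A B : Set V}
    (hA : G.IsIndepSet A) (hB : Maximal G.IsIndepSet B) : A.ncard ≤ B.ncard := by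
  have h1 := ncard_le_ringKrullDim_edgeRing K hA
  rw [h] at h1
  have h2 := depthOn_edgeRing_le_ncard K hB
  have h3 : (A.ncard : ℕ∞) ≤ B.ncard := le_trans (by exact_mod_cast h1) h2
  exact_mod_cast h3

end SimpleGraph

/-! ### Independence of edges in the random graph -/

open MeasureTheory ProbabilityTheory unitInterval

instance SimpleGraph.instDiscreteMeasurableSpace {V : Type*} [Finite V] :
    DiscreteMeasurableSpace (SimpleGraph V) :=
  have : MeasurableSingletonClass (SimpleGraph V) := ⟨fun G => by
    have := (MeasurableSet.singleton G.edgeSet).preimage SimpleGraph.measurable_edgeSet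
    convert this
    ext H
    simp⟩
  inferInstance

namespace SimpleGraph
variable {V : Type*}

/-- Membership in `S` does not depend on whether the pairs in `T` are edges. -/
def IndependentOfEdges (S : Set (SimpleGraph V)) (T : Set (Sym2 V)) : Prop :=
  ∀ G H : SimpleGraph V, (∀ e ∉ T, e ∈ G.edgeSet ↔ e ∈ H.edgeSet) → G ∈ S → H ∈ S

theorem binomialRandom_real_inter_disjoint [Finite V] (p : I) {S : Set (SimpleGraph V)}
    {T : Finset (Sym2 V)} (hT : ∀ e ∈ T, ¬ e.IsDiag) (hS : IndependentOfEdges S (T : Set (Sym2 V))) :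
    (binomialRandom V p).real (S ∩ {G | Disjoint (T : Set (Sym2 V)) G.edgeSet}) =
      (binomialRandom V p).real S * (1 - p : ℝ) ^ T.card := by
  classical
  cases nonempty_fintype V
  let ν : Sym2 V → Measure Prop := fun e =>
    toNNReal p • Measure.dirac (e ∈ (Sym2.diagSetᶜ : Set (Sym2 V))) +
      toNNReal (σ p) • Measure.dirac False
  let Φ : (Sym2 V → Prop) → SimpleGraph V := fun f => fromEdgeSet {e | f e}
  have hΦ : Measurable Φ := Measurable.of_discrete
  have hmap : binomialRandom V p = (Measure.infinitePi ν).map Φ := by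
    rw [binomialRandom_eq_map, setBernoulli_eq_map, Measure.map_map (by fun_prop) (by fun_prop)]
    rfl
  have hprob : ∀ e, IsProbabilityMeasure (ν e) := by
    intro e
    infer_instance
  have hind : iIndepFun (fun e (f : Sym2 V → Prop) => f e) (Measure.infinitePi ν) :=
    iIndepFun_infinitePi (X := fun _ a => a) (fun _ => measurable_id)
  -- Setting the coordinates in `T` to `False` expresses `S` through the coordinates outside `T`;
  -- the value is immaterial, since `S` ignores them.
  have h2 := (hind.indepFun_finset Tᶜ T disjoint_compl_left
    (fun _ => by fun_prop)).measure_inter_preimage_eq_mul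
      {g | Φ (fun e => if h : e ∈ Tᶜ then g ⟨e, h⟩ else False) ∈ S} {g | ∀ e, ¬ g e}
      (MeasurableSet.of_discrete) (MeasurableSet.of_discrete)
  have hS' : Φ ⁻¹' S = (fun (f : Sym2 V → Prop) (e : (Tᶜ : Finset _)) => f e) ⁻¹'
      {g | Φ (fun e => if h : e ∈ Tᶜ then g ⟨e, h⟩ else False) ∈ S} := by
    ext f
    have key : ∀ e ∉ (T : Set (Sym2 V)), (e ∈ (Φ f).edgeSet ↔
        e ∈ (Φ fun e => if h : e ∈ Tᶜ then f e else False).edgeSet) := by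
      intro e he
      have he' : e ∉ T := he
      simp [Φ, he']
    exact ⟨hS _ _ key, hS _ _ fun e he => (key e he).symm⟩
  have hT' : Φ ⁻¹' {G | Disjoint (T : Set (Sym2 V)) G.edgeSet} =
      (fun (f : Sym2 V → Prop) (e : T) => f e) ⁻¹' {g | ∀ e, ¬ g e} := by
    ext f
    simp only [Set.mem_preimage, Set.mem_ofPred_eq, Set.disjoint_left, Φ, edgeSet_fromEdgeSet]
    constructor
    · intro h e he
      exact h e.2 ⟨he, hT e e.2⟩
    · intro h e he he'
      exact h ⟨e, he⟩ he'.1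
  have hT2 : Measure.infinitePi ν ((fun (f : Sym2 V → Prop) (e : T) => f e) ⁻¹' {g | ∀ e, ¬ g e}) =
      ENNReal.ofReal ((1 - p : ℝ) ^ T.card) := by
    have : ((fun (f : Sym2 V → Prop) (e : T) => f e) ⁻¹' {g | ∀ e, ¬ g e}) =
        Set.pi (T : Set (Sym2 V)) fun _ => {False} := by
      ext f
      simp
    rw [this, Measure.infinitePi_pi _ fun _ _ => MeasurableSet.of_discrete,
      Finset.prod_congr rfl (g := fun _ => ENNReal.ofReal (1 - p : ℝ)), Finset.prod_const,
      ENNReal.ofReal_pow]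
    · linarith [p.2.2]
    · intro e he
      have hσ : toNNReal (σ p) = Real.toNNReal (1 - p : ℝ) :=
        NNReal.eq (by rw [Real.coe_toNNReal _ (by linarith [p.2.2])]; rfl)
      simp [ν, hT e he, ENNReal.ofReal, hσ]
  rw [hmap, map_measureReal_apply hΦ .of_discrete, map_measureReal_apply hΦ .of_discrete,
    Set.preimage_inter, hS', hT', measureReal_def, measureReal_def, h2, hT2, ENNReal.toReal_mul,
    ENNReal.toReal_ofReal]
  exact pow_nonneg (by linarith [p.2.2]) _

theorem binomialRandom_real_disjoint [Finite V] (p : I) {T : Finset (Sym2 V)}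
    (hT : ∀ e ∈ T, ¬ e.IsDiag) :
    (binomialRandom V p).real {G | Disjoint (T : Set (Sym2 V)) G.edgeSet} =
      (1 - p : ℝ) ^ T.card := by
  have := binomialRandom_real_inter_disjoint p (S := Set.univ) hT fun _ _ _ _ => trivial
  rwa [Set.univ_inter, probReal_univ, one_mul] at this

end SimpleGraph

/-! ### The greedy independent set -/

namespace SimpleGraph

section Greedy

/-- The vertices that enter the independent set built greedily along the order of `V`. -/
def IsGreedy {V : Type*} [LinearOrder V] [WellFoundedLT V] (G : SimpleGraph V) (v : V) : Prop :=
  ∀ u, u < v → G.IsGreedy u → ¬ G.Adj u v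
termination_by wellFounded_lt.wrap v

variable {V : Type*} [LinearOrder V]

theorem isGreedy_iff [WellFoundedLT V] {G : SimpleGraph V} {v : V} :
    G.IsGreedy v ↔ ∀ u, u < v → G.IsGreedy u → ¬ G.Adj u v := by
  rw [IsGreedy]

theorem maximal_isIndepSet_isGreedy [WellFoundedLT V] (G : SimpleGraph V) :
    Maximal G.IsIndepSet {v | G.IsGreedy v} := by
  refine ⟨fun u hu v hv huv => ?_, fun S hS hle v hv => ?_⟩
  · rcases lt_or_gt_of_ne huv with h | h
    · exact isGreedy_iff.mp hv u h hu
    · exact fun h' => isGreedy_iff.mp hu v h hv h'.symm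
  · exact isGreedy_iff.mpr fun u huv hu => hS (hle hu) hv huv.ne

theorem isGreedy_congr [WellFoundedLT V] {G H : SimpleGraph V} {v : V}
    (h : ∀ a b, a < v → b < v → (G.Adj a b ↔ H.Adj a b)) (w : V) (hw : w < v) :
    G.IsGreedy w ↔ H.IsGreedy w := by
  induction w using WellFoundedLT.induction with
  | ind w ih =>
    rw [isGreedy_iff, isGreedy_iff]
    refine forall₂_congr fun u hu => ?_
    rw [ih u hu (hu.trans hw), h u w (hu.trans hw) hw]

variable [Finite V]

/-- The greedy vertices below `v`. -/
noncomputable def greedyBelow (G : SimpleGraph V) (v : V) : Finset V :=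
  (Set.toFinite {u | u < v ∧ G.IsGreedy u}).toFinset

theorem mem_greedyBelow {G : SimpleGraph V} {u v : V} :
    u ∈ G.greedyBelow v ↔ u < v ∧ G.IsGreedy u := by
  simp [greedyBelow]

/-- The set `S` of greedy vertices below `v` depends only on edges below `v`. Given `S`, the vertex
`v` is greedy only if all `|S| ≥ s` pairs joining it to `S` are non-edges, and these pairs are
independent of `S`. -/
theorem binomialRandom_real_greedyBelow_le (p : I) (v : V) (s : ℕ) :
    (binomialRandom V p).real {G | s ≤ (G.greedyBelow v).card ∧ G.IsGreedy v} ≤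
      (1 - p : ℝ) ^ s := by
  classical
  cases nonempty_fintype V
  have h1p : (0 : ℝ) ≤ 1 - p := by linarith [p.2.2]
  let E : Finset V → Set (SimpleGraph V) := fun S => {G | G.greedyBelow v = S}
  -- Erasing `v` keeps diagonal pairs out for every `S`; it changes nothing for the sets used, which
  -- omit `v`.
  let T : Finset V → Finset (Sym2 V) := fun S => (S.erase v).image fun u => s(u, v)
  have hsub : {G : SimpleGraph V | s ≤ (G.greedyBelow v).card ∧ G.IsGreedy v} ⊆
      ⋃ S ∈ Finset.univ.filter fun S : Finset V => s ≤ S.card ∧ v ∉ S,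
        E S ∩ {G | Disjoint (T S : Set (Sym2 V)) G.edgeSet} := by
    rintro G ⟨hs, hG⟩
    simp only [Set.mem_iUnion]
    refine ⟨G.greedyBelow v, ?_, rfl, ?_⟩
    · simp [hs, mem_greedyBelow]
    · simp only [Set.mem_ofPred_eq, Set.disjoint_left, T]
      intro e he
      obtain ⟨u, hu, rfl⟩ := Finset.mem_image.mp (Finset.mem_coe.mp he)
      have := mem_greedyBelow.mp (Finset.mem_of_mem_erase hu)
      exact isGreedy_iff.mp hG u this.1 this.2
  have hprob : ∀ S ∈ Finset.univ.filter fun S : Finset V => s ≤ S.card ∧ v ∉ S,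
      (binomialRandom V p).real (E S ∩ {G | Disjoint (T S : Set (Sym2 V)) G.edgeSet}) ≤
        (binomialRandom V p).real (E S) * (1 - p : ℝ) ^ s := by
    intro S hS
    obtain ⟨hs, hv⟩ := (Finset.mem_filter.mp hS).2
    have hcard : (T S).card = S.card := by
      rw [Finset.card_image_of_injective _ fun a b h => Sym2.congr_left.mp h,
        Finset.erase_eq_of_notMem hv]
    rw [binomialRandom_real_inter_disjoint p, hcard]
    · exact mul_le_mul_of_nonneg_left
        (pow_le_pow_of_le_one h1p (by linarith [p.2.1]) hs) measureReal_nonneg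
    · intro e he
      obtain ⟨u, hu, rfl⟩ := Finset.mem_image.mp he
      simpa using Finset.ne_of_mem_erase hu
    · intro G H hGH hG
      have key : ∀ a b, a < v → b < v → (G.Adj a b ↔ H.Adj a b) := by
        intro a b ha hb
        refine hGH s(a, b) fun he => ?_
        obtain ⟨u, hu, hue⟩ := Finset.mem_image.mp (Finset.mem_coe.mp he)
        have hv : v ∈ s(a, b) := hue ▸ Sym2.mem_mk_right u v
        rcases Sym2.mem_iff.mp hv with h | h
        · exact ha.ne h.symm
        · exact hb.ne h.symm
      refine Eq.trans ?_ hG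
      ext u
      rw [mem_greedyBelow, mem_greedyBelow]
      exact and_congr_right fun hu => (isGreedy_congr key u hu).symm
  calc _ ≤ _ := measureReal_mono hsub (measure_ne_top _ _)
    _ ≤ _ := measureReal_biUnion_finset_le _ _
    _ ≤ _ := Finset.sum_le_sum hprob
    _ = (∑ S ∈ Finset.univ.filter fun S : Finset V => s ≤ S.card ∧ v ∉ S,
          (binomialRandom V p).real (E S)) * (1 - p : ℝ) ^ s := by rw [Finset.sum_mul]
    _ ≤ 1 * (1 - p : ℝ) ^ s := by
      refine mul_le_mul_of_nonneg_right ?_ (pow_nonneg h1p s)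
      rw [← measureReal_biUnion_finset]
      · exact measureReal_le_one
      · intro S _ S' _ hne
        exact Set.disjoint_left.mpr fun G hG hG' => hne (hG.symm.trans hG')
      · exact fun _ _ => .of_discrete
    _ = _ := one_mul _

/-- If more than `s` vertices are greedy, the last of them has at least `s` greedy predecessors;
then a union bound over vertices applies. -/
theorem binomialRandom_real_greedy_card_le (p : I) (s : ℕ) :
    (binomialRandom V p).real {G | s < {v | G.IsGreedy v}.ncard} ≤
      Nat.card V * (1 - p : ℝ) ^ s := by
  classical
  cases nonempty_fintype V
  have hsub : {G : SimpleGraph V | s < {v | G.IsGreedy v}.ncard} ⊆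
      ⋃ v ∈ (Finset.univ : Finset V), {G | s ≤ (G.greedyBelow v).card ∧ G.IsGreedy v} := by
    intro G hG
    have hG : s < {v | G.IsGreedy v}.ncard := hG
    obtain ⟨v, hv, hmax⟩ := Set.exists_max_image {v | G.IsGreedy v} id (Set.toFinite _)
      (Set.nonempty_of_ncard_ne_zero (by omega))
    simp only [Set.mem_iUnion]
    refine ⟨v, Finset.mem_univ v, ?_, hv⟩
    have : {v | G.IsGreedy v} = insert v (G.greedyBelow v : Set V) := by
      ext u
      simp only [Set.mem_insert_iff, Finset.mem_coe, mem_greedyBelow, Set.mem_ofPred_eq]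
      constructor
      · exact fun hu => (hmax u hu).eq_or_lt.imp_right fun h => ⟨h, hu⟩
      · rintro (rfl | h)
        exacts [hv, h.2]
    rw [this] at hG
    have h2 := Set.ncard_insert_le v (G.greedyBelow v : Set V)
    rw [Set.ncard_coe_finset] at h2
    omega
  calc _ ≤ _ := measureReal_mono hsub (measure_ne_top _ _)
    _ ≤ _ := measureReal_biUnion_finset_le _ _
    _ ≤ ∑ v : V, (1 - p : ℝ) ^ s :=
      Finset.sum_le_sum fun v _ => binomialRandom_real_greedyBelow_le p v s
    _ = _ := by simp

end Greedy

end SimpleGraph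

/-! ### Second moment method for large independent sets -/

/-- The Chung–Erdős inequality: Cauchy–Schwarz applied to `X = 1_U · X`, where `X` counts the events
that occur and `U` is their union. -/
theorem MeasureTheory.sq_sum_measureReal_le {Ω ι : Type*} [Finite Ω] [MeasurableSpace Ω]
    [MeasurableSingletonClass Ω] (μ : Measure Ω) [IsFiniteMeasure μ] (s : Finset ι)
    (E : ι → Set Ω) :
    (∑ i ∈ s, μ.real (E i)) ^ 2 ≤
      μ.real (⋃ i ∈ s, E i) * ∑ i ∈ s, ∑ j ∈ s, μ.real (E i ∩ E j) := by
  classical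
  cases nonempty_fintype Ω
  have hμ : ∀ A : Set Ω, μ.real A = ∑ ω, μ.real {ω} * A.indicator 1 ω := by
    intro A
    have h := sum_measureReal_singleton (μ := μ) A.toFinset
    rw [Set.coe_toFinset] at h
    rw [← h, ← Finset.sum_subset (Finset.subset_univ A.toFinset) fun ω _ hω => by
      rw [Set.mem_toFinset] at hω; simp [hω]]
    exact Finset.sum_congr rfl fun ω hω => by
      rw [Set.mem_toFinset] at hω; simp [hω]
  set U := ⋃ i ∈ s, E i
  let X : Ω → ℝ := fun ω => ∑ i ∈ s, (E i).indicator 1 ω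
  have h1 : ∑ i ∈ s, μ.real (E i) =
      ∑ ω, (Real.sqrt (μ.real {ω}) * U.indicator 1 ω) * (Real.sqrt (μ.real {ω}) * X ω) := by
    simp_rw [hμ (E _)]
    rw [Finset.sum_comm]
    refine Finset.sum_congr rfl fun ω _ => ?_
    rw [mul_mul_mul_comm, Real.mul_self_sqrt measureReal_nonneg, ← Finset.mul_sum]
    congr 1
    by_cases hω : ω ∈ U
    · simp [hω, X]
    · rw [Set.indicator_of_notMem hω, zero_mul]
      refine Finset.sum_eq_zero fun i hi => Set.indicator_of_notMem (fun h => hω ?_) _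
      exact Set.mem_biUnion hi h
  have h2 : μ.real U = ∑ ω, (Real.sqrt (μ.real {ω}) * U.indicator 1 ω) ^ 2 := by
    rw [hμ U]
    refine Finset.sum_congr rfl fun ω _ => ?_
    rw [mul_pow, Real.sq_sqrt measureReal_nonneg]
    by_cases hω : ω ∈ U <;> simp [hω]
  have h3 : ∑ i ∈ s, ∑ j ∈ s, μ.real (E i ∩ E j) = ∑ ω, (Real.sqrt (μ.real {ω}) * X ω) ^ 2 := by
    simp_rw [hμ (E _ ∩ E _), mul_pow, Real.sq_sqrt measureReal_nonneg, X, sq, Finset.sum_mul_sum,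
      Set.inter_indicator_one, Pi.mul_apply, Finset.mul_sum]
    rw [Finset.sum_comm (s := Finset.univ)]
    exact Finset.sum_congr rfl fun i _ => Finset.sum_comm
  rw [h1, h2, h3]
  exact Finset.sum_mul_sq_le_sq_mul_sq _ _ _

namespace SimpleGraph
variable {V : Type*}

open scoped Classical in
/-- The pairs of distinct elements of a finite set. -/
noncomputable def pairs (A : Finset V) : Finset (Sym2 V) := A.offDiag.image Sym2.mk.uncurry

theorem mem_pairs {A : Finset V} {e : Sym2 V} :
    e ∈ pairs A ↔ ¬ e.IsDiag ∧ ∀ v ∈ e, v ∈ A := by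
  induction e with
  | _ a b =>
    simp only [pairs, Finset.mem_image, Finset.mem_offDiag, Prod.exists, Function.uncurry_apply_pair,
      Sym2.eq_iff, Sym2.mk_isDiag_iff, Sym2.mem_iff, forall_eq_or_imp, forall_eq]
    grind

theorem card_pairs (A : Finset V) : (pairs A).card = A.card.choose 2 := by
  classical
  exact Sym2.card_image_offDiag A

theorem isIndepSet_iff_disjoint_pairs {G : SimpleGraph V} {A : Finset V} :
    G.IsIndepSet (A : Set V) ↔ Disjoint (pairs A : Set (Sym2 V)) G.edgeSet := by
  rw [Set.disjoint_left]
  refine ⟨fun h e => ?_, fun h a ha b hb hab hadj => h (a := s(a, b)) ?_ hadj⟩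
  · induction e with
    | _ a b =>
      intro he
      obtain ⟨hd, hm⟩ := mem_pairs.mp (Finset.mem_coe.mp he)
      exact h (hm a (by simp)) (hm b (by simp)) (by simpa using hd)
  · refine Finset.mem_coe.mpr (mem_pairs.mpr ⟨by simpa using hab, fun v hv => ?_⟩)
    rcases Sym2.mem_iff.mp hv with rfl | rfl
    exacts [ha, hb]

theorem binomialRandom_real_isIndepSet [Finite V] (p : I) (A : Finset V) :
    (binomialRandom V p).real {G | G.IsIndepSet (A : Set V)} = (1 - p : ℝ) ^ A.card.choose 2 := by
  simp_rw [isIndepSet_iff_disjoint_pairs]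
  rw [binomialRandom_real_disjoint p fun e he => (mem_pairs.mp he).1, card_pairs]

open scoped Classical in
theorem binomialRandom_real_isIndepSet_inter [Finite V] (p : I) (A B : Finset V) :
    (binomialRandom V p).real
      ({G | G.IsIndepSet (A : Set V)} ∩ {G | G.IsIndepSet (B : Set V)}) *
        (1 - p : ℝ) ^ (A ∩ B).card.choose 2 =
      (1 - p : ℝ) ^ A.card.choose 2 * (1 - p : ℝ) ^ B.card.choose 2 := by
  have hinter : pairs (A ∩ B) = pairs A ∩ pairs B := by
    ext e
    simp only [mem_pairs, Finset.mem_inter]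
    grind
  have hset : ({G : SimpleGraph V | G.IsIndepSet (A : Set V)} ∩ {G | G.IsIndepSet (B : Set V)}) =
      {G | Disjoint ((pairs A ∪ pairs B : Finset _) : Set (Sym2 V)) G.edgeSet} := by
    ext G
    simp only [Set.mem_inter_iff, Set.mem_ofPred_eq, isIndepSet_iff_disjoint_pairs,
      Finset.coe_union, Set.disjoint_union_left]
  rw [hset, binomialRandom_real_disjoint p, ← card_pairs, ← card_pairs, ← card_pairs, hinter,
    ← pow_add, ← pow_add, Finset.card_union_add_card_inter]
  intro e he
  rcases Finset.mem_union.mp he with h | h <;> exact (mem_pairs.mp h).1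

theorem sq_pow_choose_two_le {r : ℝ} (hr : 1 ≤ r) {j k : ℕ} (hjk : j ≤ k) :
    (r ^ 2) ^ j.choose 2 ≤ (r ^ (k - 1)) ^ j := by
  rw [← pow_mul, ← pow_mul]
  refine pow_le_pow_right₀ hr ?_
  rw [Nat.choose_two_right, Nat.mul_div_cancel' (Nat.even_mul_pred_self j).two_dvd, mul_comm]
  exact Nat.mul_le_mul_right j (by omega)

theorem card_filter_eq_le {k m : ℕ} (f g : Fin k → Fin m) :
    (Finset.univ.filter fun i => f i = g i).card ≤ k :=
  (Finset.card_filter_le _ _).trans (by simp)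

/-- The sum factors over coordinates: in each, one value agrees with `f` and `m - 1` do not. -/
theorem sum_pow_card_filter_eq {k m : ℕ} (f : Fin k → Fin m) (x : ℝ) :
    ∑ g : Fin k → Fin m, x ^ (Finset.univ.filter fun i => f i = g i).card = (m - 1 + x) ^ k := by
  have h : ∀ g : Fin k → Fin m, x ^ (Finset.univ.filter fun i => f i = g i).card =
      ∏ i, if f i = g i then x else 1 := by
    intro g
    rw [Finset.prod_ite, Finset.prod_const, Finset.prod_const_one, mul_one]
  simp_rw [h]
  rw [← Fintype.prod_sum (f := fun i y => if f i = y then x else 1)]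
  have h2 : ∀ i, ∑ y : Fin m, (if f i = y then x else 1) = m - 1 + x := by
    intro i
    have : ∀ y : Fin m, (if f i = y then x else 1) = (if f i = y then x - 1 else 0) + 1 := by
      intro y
      split_ifs <;> ring
    simp_rw [this]
    rw [Finset.sum_add_distrib, Finset.sum_ite_eq]
    simp
    ring
  simp_rw [h2]
  simp

/-- The second moment bound for independent transversals of `k` disjoint blocks of size `m`. -/
theorem one_sub_le_binomialRandom_real_exists_isIndepSet [Finite V] (p : I) {k m : ℕ} (hm : 0 < m)
    (φ : Fin k × Fin m ↪ V) {r : ℝ} (hr : 1 ≤ r) (hrp : r ^ 2 * (1 - p : ℝ) = 1) :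
    1 - k * r ^ (k - 1) / m ≤
      (binomialRandom V p).real {G | ∃ A : Set V, G.IsIndepSet A ∧ A.ncard = k} := by
  classical
  set q : ℝ := 1 - p with hq
  have hq0 : 0 < q := by
    by_contra! h
    nlinarith [sq_nonneg r]
  set β := r ^ (k - 1) with hβ
  have hβ0 : 0 < β := by positivity
  let A : (Fin k → Fin m) → Finset V := fun f => Finset.univ.map
    ⟨fun i => φ (i, f i), fun i j h => (Prod.ext_iff.mp (φ.injective h)).1⟩
  have hA : ∀ f, (A f).card = k := fun f => by simp [A]
  have hAA : ∀ f g, (A f ∩ A g).card = (Finset.univ.filter fun i => f i = g i).card := by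
    intro f g
    have : A f ∩ A g = (Finset.univ.filter fun i => f i = g i).map
        ⟨fun i => φ (i, f i), fun i j h => (Prod.ext_iff.mp (φ.injective h)).1⟩ := by
      ext v
      simp only [A, Finset.mem_inter, Finset.mem_map, Finset.mem_univ, true_and,
        Finset.mem_filter]
      constructor
      · rintro ⟨⟨i, rfl⟩, j, hj⟩
        have := Prod.ext_iff.mp (φ.injective hj)
        obtain rfl : j = i := this.1
        exact ⟨j, this.2.symm, rfl⟩
      · rintro ⟨i, hi, rfl⟩
        exact ⟨⟨i, rfl⟩, i, by
          change φ (i, g i) = φ (i, f i)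
          rw [hi]⟩
    rw [this, Finset.card_map]
  set c := k.choose 2
  let E : (Fin k → Fin m) → Set (SimpleGraph V) := fun f => {G | G.IsIndepSet (A f : Set V)}
  have hE : ∀ f, (binomialRandom V p).real (E f) = q ^ c := fun f => by
    rw [binomialRandom_real_isIndepSet, hA]
  -- Transversals agreeing in `j` blocks share `j.choose 2` pairs, which gains a factor `q⁻¹ = r ^
  -- 2` per pair. Since `j ≤ k`, the gain is at most `β ^ j`, a form that can be summed
  -- coordinatewise.
  have hEE : ∀ f g, (binomialRandom V p).real (E f ∩ E g) ≤
      q ^ c * q ^ c * β ^ (Finset.univ.filter fun i => f i = g i).card := by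
    intro f g
    have h := binomialRandom_real_isIndepSet_inter p (A f) (A g)
    rw [hA, hA, hAA] at h
    have h2 := sq_pow_choose_two_le hr (card_filter_eq_le f g)
    set j := (Finset.univ.filter fun i => f i = g i).card
    have h3 : (r ^ 2) ^ j.choose 2 * q ^ j.choose 2 = 1 := by rw [← mul_pow, hrp, one_pow]
    calc (binomialRandom V p).real (E f ∩ E g)
        = (binomialRandom V p).real (E f ∩ E g) * q ^ j.choose 2 * (r ^ 2) ^ j.choose 2 := by
          rw [mul_assoc, mul_comm (q ^ _), h3, mul_one]
      _ = q ^ c * q ^ c * (r ^ 2) ^ j.choose 2 := by rw [h]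
      _ ≤ _ := by gcongr
  have hsub : (⋃ f ∈ Finset.univ, E f) ⊆ {G | ∃ A : Set V, G.IsIndepSet A ∧ A.ncard = k} := by
    intro G hG
    obtain ⟨f, -, hf⟩ := Set.mem_iUnion₂.mp hG
    exact ⟨A f, hf, by rw [Set.ncard_coe_finset, hA]⟩
  refine le_trans ?_ (measureReal_mono hsub (measure_ne_top _ _))
  set P := (binomialRandom V p).real (⋃ f ∈ Finset.univ, E f)
  have hCE := sq_sum_measureReal_le (binomialRandom V p) Finset.univ E
  have hm' : (0 : ℝ) < m := by exact_mod_cast hm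
  have hm1 : (1 : ℝ) ≤ m := by exact_mod_cast hm
  have hS : ∑ f, ∑ g, (binomialRandom V p).real (E f ∩ E g) ≤
      (m : ℝ) ^ k * (q ^ c * q ^ c * (m + β) ^ k) := by
    calc _ ≤ ∑ f : Fin k → Fin m, ∑ g : Fin k → Fin m,
          q ^ c * q ^ c * β ^ (Finset.univ.filter fun i => f i = g i).card :=
        Finset.sum_le_sum fun f _ => Finset.sum_le_sum fun g _ => hEE f g
      _ = ∑ f : Fin k → Fin m, q ^ c * q ^ c * (m - 1 + β) ^ k := by
        simp_rw [← Finset.mul_sum, sum_pow_card_filter_eq]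
      _ = (m : ℝ) ^ k * (q ^ c * q ^ c * (m - 1 + β) ^ k) := by simp
      _ ≤ _ := by gcongr; linarith
  have hL : ∑ f, (binomialRandom V p).real (E f) = (m : ℝ) ^ k * q ^ c := by
    simp [hE]
  rw [hL] at hCE
  have hfin : (m : ℝ) ^ k ≤ P * (m + β) ^ k := by
    have hpos : 0 < (m : ℝ) ^ k * (q ^ c * q ^ c) := by positivity
    refine le_of_mul_le_mul_left ?_ hpos
    calc _ = ((m : ℝ) ^ k * q ^ c) ^ 2 := by ring
      _ ≤ _ := hCE
      _ ≤ P * ((m : ℝ) ^ k * (q ^ c * q ^ c * (m + β) ^ k)) := by gcongr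
      _ = _ := by ring
  -- Bernoulli's inequality; the right side equals `(m / (m + β)) ^ k`, the lower bound for `P`
  -- given by `hfin`.
  have hbern : 1 - k * β / m ≤ (1 - β / (m + β)) ^ k := by
    have h1 := one_add_mul_le_pow (a := -(β / (m + β))) (by
      have : β / (m + β) ≤ 1 := (div_le_one (by positivity)).mpr (by linarith)
      linarith) k
    have h2 : β / (m + β) ≤ β / m := by gcongr; linarith
    have h3 : (k : ℝ) * (β / (m + β)) ≤ k * (β / m) := by gcongr
    rw [mul_div_assoc]
    calc _ ≤ 1 + k * -(β / (m + β)) := by linarith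
      _ ≤ _ := h1
      _ = _ := by ring
  refine hbern.trans ?_
  have : 1 - β / (m + β) = m / (m + β) := by
    rw [eq_div_iff (by positivity), sub_mul, div_mul_cancel₀ _ (by positivity)]
    ring
  rw [this, div_pow, div_le_iff₀ (by positivity)]
  exact hfin

end SimpleGraph

/-! ### Choice of parameters and the limit -/

namespace SimpleGraph

theorem le_binomialRandom_real_not_isCohenMacaulay (K : Type*) [Field K] (p : I) {n t m : ℕ}
    (hm : 0 < m) (hmn : (t + 1) * m ≤ n) {r : ℝ} (hr : 1 ≤ r) (hrp : r ^ 2 * (1 - p : ℝ) = 1) :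
    1 - ((t + 1) * r ^ t / m + n * (1 - p : ℝ) ^ t) ≤
      (binomialRandom (Fin n) p).real {G | ¬ G.IsCohenMacaulay K} := by
  let φ : Fin (t + 1) × Fin m ↪ Fin n :=
    finProdFinEquiv.toEmbedding.trans (Fin.castLEEmb hmn)
  have h1 := one_sub_le_binomialRandom_real_exists_isIndepSet p hm φ hr hrp
  have h2 := binomialRandom_real_greedy_card_le (V := Fin n) p t
  set E := {G : SimpleGraph (Fin n) | ∃ A : Set (Fin n), G.IsIndepSet A ∧ A.ncard = t + 1}
  set F := {G : SimpleGraph (Fin n) | t < {v | G.IsGreedy v}.ncard}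
  have hsub : E ⊆ {G | ¬ G.IsCohenMacaulay K} ∪ F := by
    rintro G ⟨A, hA, hcard⟩
    by_cases hF : G ∈ F
    · exact Or.inr hF
    · refine Or.inl fun hCM => hF ?_
      have := hCM.ncard_le K hA (maximal_isIndepSet_isGreedy G)
      rw [hcard] at this
      exact this
  have h3 := (measureReal_mono hsub (measure_ne_top _ _)).trans
    (measureReal_union_le (μ := binomialRandom (Fin n) p) _ _)
  simp only [Nat.card_eq_fintype_card, Fintype.card_fin, Nat.cast_add, Nat.cast_one,
    Nat.add_sub_cancel] at h1 h2
  linarith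

open Filter Topology in
theorem tendsto_ceil_log_add_one_div_rpow (a : ℝ) (ha : 0 ≤ a) :
    Tendsto (fun n : ℕ => ((⌈a * Real.log n⌉₊ + 1 : ℕ) : ℝ) / (n : ℝ) ^ (1 / 8 : ℝ)) atTop
      (𝓝 0) := by
  have hpow : Tendsto (fun n : ℕ => (n : ℝ) ^ (1 / 8 : ℝ)) atTop atTop :=
    (tendsto_rpow_atTop (by norm_num)).comp tendsto_natCast_atTop_atTop
  have hlog : Tendsto (fun n : ℕ => Real.log n / (n : ℝ) ^ (1 / 8 : ℝ)) atTop (𝓝 0) :=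
    (isLittleO_log_rpow_atTop (by norm_num)).tendsto_div_nhds_zero.comp
      tendsto_natCast_atTop_atTop
  have hbd : Tendsto (fun n : ℕ => a * (Real.log n / (n : ℝ) ^ (1 / 8 : ℝ)) +
      2 / (n : ℝ) ^ (1 / 8 : ℝ)) atTop (𝓝 0) := by
    simpa using (hlog.const_mul a).add (hpow.const_div_atTop 2)
  refine squeeze_zero (fun n => by positivity) (fun n => ?_) hbd
  rw [← mul_div_assoc, ← add_div]
  gcongr
  have := (Nat.ceil_lt_add_one (mul_nonneg ha (Real.log_natCast_nonneg n))).le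
  push_cast
  linarith

/-- With `t ≈ (3/4) log n / log r` both error terms are small; here `x = n ^ (1/8)`. -/
theorem error_le {r q x : ℝ} {n t : ℕ} (hr : 1 ≤ r) (hrq : r ^ 2 * q = 1) (hn : (n : ℝ) = x ^ 8)
    (hx : 1 ≤ x) (htx : (t + 1 : ℝ) ≤ x) (hlo : x ^ 6 ≤ r ^ t) (hhi : r ^ t ≤ r * x ^ 6) :
    (t + 1) * r ^ t / (n / (t + 1) : ℕ) + n * q ^ t ≤ 2 * r * ((t + 1) / x) ^ 2 + (1 / x) ^ 4 := by
  have hx0 : 0 < x := by linarith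
  have hq0 : 0 < q := by
    by_contra! h
    nlinarith [sq_nonneg r]
  have ht0 : (0 : ℝ) < t + 1 := by positivity
  have hxn : x ≤ n := hn ▸ le_self_pow₀ hx (by norm_num)
  -- The integer quotient is at least 1, so rounding down loses at most a factor 2.
  have hdiv : (n : ℝ) / (2 * (t + 1)) ≤ (n / (t + 1) : ℕ) := by
    have h1 : 1 ≤ n / (t + 1) := (Nat.one_le_div_iff (by omega)).mpr (by
      have := htx.trans hxn
      exact_mod_cast this)
    have h2 : (n : ℝ) / (t + 1) < (n / (t + 1) : ℕ) + 1 := by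
      have := Nat.lt_floor_add_one ((n : ℝ) / ((t + 1 : ℕ) : ℝ))
      rw [Nat.floor_div_eq_div] at this
      exact_mod_cast this
    have h3 : (1 : ℝ) ≤ (n / (t + 1) : ℕ) := by exact_mod_cast h1
    have h4 : (n : ℝ) / (2 * (t + 1)) = (n : ℝ) / (t + 1) / 2 := by field_simp
    linarith
  have hn0 : (0 : ℝ) < n := by rw [hn]; positivity
  refine add_le_add ?_ ?_
  · calc (t + 1) * r ^ t / (n / (t + 1) : ℕ) ≤ (t + 1) * (r * x ^ 6) / (n / (2 * (t + 1))) := by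
          gcongr
      _ = 2 * r * ((t + 1) / x) ^ 2 := by
          rw [hn]
          field_simp
  · have h1 : r ^ t * r ^ t * q ^ t = 1 := by
      rw [← mul_pow, ← mul_pow, ← sq, hrq, one_pow]
    have h2 : x ^ 6 * x ^ 6 * q ^ t ≤ 1 := by
      rw [← h1]
      gcongr
    rw [hn, div_pow, one_pow, le_div_iff₀ (by positivity)]
    calc _ = x ^ 6 * x ^ 6 * q ^ t := by ring
      _ ≤ 1 := h2

end SimpleGraph

open SimpleGraph Filter Topology in
theorem mainTheorem9 (K : Type*) [Field K] :
    AlmostAllGraphs (fun _ G => ¬ G.IsCohenMacaulay K) := by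
  intro p hp0 hp1
  have hp0' : (0 : ℝ) < p := hp0
  have hp1' : (p : ℝ) < 1 := hp1
  set q : ℝ := 1 - p with hq
  have hq0 : 0 < q := by linarith
  set r : ℝ := Real.sqrt q⁻¹ with hr
  have hrq : r ^ 2 * q = 1 := by
    rw [hr, Real.sq_sqrt (by positivity), inv_mul_cancel₀ hq0.ne']
  have hr1 : 1 < r := by
    rw [hr, Real.lt_sqrt zero_le_one, one_pow]
    exact (one_lt_inv₀ hq0).mpr (by linarith)
  have hlogr : 0 < Real.log r := Real.log_pos hr1
  -- This makes `r ^ t` about `n ^ (3/4)`, so that `q ^ t` is about `n ^ (-3/2)`: small enough for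
  -- the greedy bound, while `r ^ t` stays well below the block size.
  set a : ℝ := 3 / (4 * Real.log r) with ha
  have ha0 : 0 ≤ a := by positivity
  let t : ℕ → ℕ := fun n => ⌈a * Real.log n⌉₊
  let x : ℕ → ℝ := fun n => (n : ℝ) ^ (1 / 8 : ℝ)
  have hx : Tendsto x atTop atTop :=
    (tendsto_rpow_atTop (by norm_num)).comp tendsto_natCast_atTop_atTop
  have htx : Tendsto (fun n => (t n + 1 : ℝ) / x n) atTop (𝓝 0) := by
    simpa [t, x] using tendsto_ceil_log_add_one_div_rpow a ha0
  have herr : Tendsto (fun n => 1 - (2 * r * ((t n + 1 : ℝ) / x n) ^ 2 + (1 / x n) ^ 4)) atTop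
      (𝓝 1) := by
    simpa using (((htx.pow 2).const_mul (2 * r)).add ((hx.const_div_atTop 1).pow 4)).const_sub 1
  have hreal : Tendsto (fun n : ℕ =>
      (binomialRandom (Fin n) p).real {G | ¬ G.IsCohenMacaulay K}) atTop (𝓝 1) := by
    refine tendsto_of_tendsto_of_tendsto_of_le_of_le' herr tendsto_const_nhds ?_
      (Eventually.of_forall fun n => measureReal_le_one)
    filter_upwards [hx.eventually_ge_atTop 1, htx.eventually_le_const one_pos,
      eventually_ge_atTop 1] with n hx1 htx1 hn1
    have hn0 : (0 : ℝ) < n := by exact_mod_cast hn1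
    have hnx : (n : ℝ) = x n ^ 8 := by
      rw [← Real.rpow_natCast, ← Real.rpow_mul hn0.le]
      norm_num
    have hx0 : 0 < x n := by linarith
    have htx2 : (t n + 1 : ℝ) ≤ x n := (div_le_one hx0).mp htx1
    have hlogx : Real.log (x n ^ 6) = a * Real.log n * Real.log r := by
      rw [Real.log_pow, Real.log_rpow hn0, ha]
      field_simp
      norm_num
      ring
    have hr0 : 0 < r := by linarith
    have hlo : x n ^ 6 ≤ r ^ t n := by
      rw [← Real.log_le_log_iff (by positivity) (by positivity), hlogx, Real.log_pow]
      gcongr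
      exact Nat.le_ceil _
    have hhi : r ^ t n ≤ r * x n ^ 6 := by
      rw [← Real.log_le_log_iff (by positivity) (by positivity), Real.log_mul (by positivity)
        (by positivity), hlogx, Real.log_pow]
      have := (Nat.ceil_lt_add_one (mul_nonneg ha0 (Real.log_natCast_nonneg n))).le
      calc (t n : ℝ) * Real.log r ≤ (a * Real.log n + 1) * Real.log r := by gcongr
        _ = _ := by ring
    have hxn : x n ≤ n := by
      conv_rhs => rw [hnx]
      exact le_self_pow₀ hx1 (by norm_num)
    have htn : t n + 1 ≤ n := by exact_mod_cast htx2.trans hxn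
    refine le_trans ?_ (le_binomialRandom_real_not_isCohenMacaulay K p (t := t n)
      (m := n / (t n + 1)) (Nat.div_pos htn (by omega)) (Nat.mul_div_le _ _) hr1.le hrq)
    exact sub_le_sub_left (error_le hr1.le hrq hnx hx1 htx2 hlo hhi) 1
  have := ENNReal.tendsto_ofReal hreal
  simpa [ofReal_measureReal] using this
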